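/- Setting. Fix a first-order alphabet of function symbols (at least one of them a constant), predicate symbols, and a distinguished equality predicate $=$. A predicate definition is a pair $(p(V_1,\ldots,V_n),\ \exists W[D])$, where $p$ is a predicate symbol other than $=$, the $V_i$ are distinct variables, $D=C_1\lor\cdots\lor C_k$ with $k>0$ is a disjunction of finite (possibly empty) conjunctions of literals, and $W=\mathrm{vars}(D)\setminus\{V_1,\ldots,V_n\}$; a literal is an atom (possibly an equality) or a negated atom. A program $P$ is a finite set of predicate definitions, at most one for each predicate symbol. A head grounding of a definition $(H,\exists W[D])$ is an instance in which the variables of $H$ have been replaced by ground terms and those of $W$ are unchanged. Interpretations. A four-valued interpretation is a pair $I=(T_I,F_I)$ of sets of ground atoms such that, for ground terms $s,t$, the atom $s=t$ is in $T_I$ iff $s$ and $t$ are identical, and in $F_I$ iff they are not. $I$ makes a ground atom $A$ true (false) iff $A\in T_I$ ($A\in F_I$), and $\lnot A$ true (false) iff it makes $A$ false (true); it makes a ground conjunction true iff it makes all its literals true, and false iff it makes some literal false; a ground disjunction true iff it makes some disjunct true, and false iff it makes all disjuncts false; $\exists W[D]$ true iff it makes some ground instance of $D$ true, and false iff it makes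 all ground instances of $D$ false. The value $I(\cdot)$ is $\mathbf t$ (true, not false), $\mathbf f$ (false, not true), $\mathbf u$ (neither) or $\mathbf i$ (both). The information ordering on truth values is given by $b_1\sqsubseteq b_2$ iff $b_1=\mathbf u$ or $b_1=b_2$ or $b_2=\mathbf i$; on interpretations it is taken pointwise, that is, $I\sqsubseteq J$ iff $T_I\subseteq T_J$ and $F_I\subseteq F_J$. Immediate consequence. $\Phi_P(I)$ is the interpretation in which a ground atom $H$ that is not an equality has the value $I(B)$, where $(H,B)$ is the head grounding with head $H$ of a definition in $P$, and the value $\mathbf f$ if the predicate of $H$ has no definition in $P$. The operator $\Phi_P$ is monotone for $\sqsubseteq$ on the complete lattice of interpretations; $\mathrm{lfp}(\Phi_P)$ is its least fixed point. Operational semantics. A goal is a finite conjunction of literals. A ground atom succeeds if, for some computation rule, it has a successful SLDNF derivation, and it finitely fails if, for some computation rule, it has a finitely failed SLDNF tree. Here a computation rule selects at each node any literal of the goal, a negated atom only if it is ground. A selected atom $p(\bar t)$ is replaced by the disjuncts of the body of the definition of $p$, with $\bar t$ substituted for the head variables and the local variables renamed apart from the goal (one child for each disjunct, and immediate failure if $p$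 has no definition). A selected equality is removed and a most general unifier of its sides is applied to the rest of the goal, with failure if there is no unifier. A selected ground $\lnot A$ is removed if $A$ finitely fails, and makes the goal fail if $A$ succeeds. The empty goal is success. Theorem. Let $P$ be a program and $I$ a four-valued interpretation with $\mathrm{lfp}(\Phi_P)\sqsubseteq I$. Then for every ground atom $A$: 1. if $I(A)=\mathbf t$, then $A$ does not finitely fail; 2. if $I(A)=\mathbf f$, then $A$ does not succeed; 3. if $I(A)=\mathbf u$, then $A$ neither finitely fails nor succeeds. -/

import Mathlib

universe u v

namespace LogicProg

/-! ## Syntax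

The alphabet is a first-order language `L`: its function symbols build the terms, its relation
symbols are the predicate symbols other than equality.  Variables are natural numbers.  A syntactic
object over the empty type of variables is a ground one. -/

/-- Atoms over variables in `α`; `eq` is the distinguished equality predicate. -/
inductive Atom (L : FirstOrder.Language.{u, v}) (α : Type) : Type (max u v)
  | eq (s t : L.Term α) : Atom L α
  | rel {n : ℕ} (p : L.Relations n) (ts : Fin n → L.Term α) : Atom L α

/-- A literal is an atom or a negated atom. -/
inductive Literal (L : FirstOrder.Language.{u, v}) (α : Type) : Type (max u v)
  | pos (A : Atom L α) : Literal L α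
  | neg (A : Atom L α) : Literal L α

/-- A conjunction of literals (the empty one is the trivially true body). -/
abbrev Conj (L : FirstOrder.Language.{u, v}) (α : Type) : Type (max u v) := List (Literal L α)

/-- A disjunction of conjunctions. -/
abbrev Disj (L : FirstOrder.Language.{u, v}) (α : Type) : Type (max u v) := List (Conj L α)

variable {L : FirstOrder.Language.{u, v}} {α β : Type}

/-- Apply a substitution to an atom. -/
def Atom.subst (σ : α → L.Term β) : Atom L α → Atom L β
  | .eq s t => .eq (s.subst σ) (t.subst σ)
  | .rel p ts => .rel p (fun i => (ts i).subst σ)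

/-- Apply a substitution to a literal. -/
def Literal.subst (σ : α → L.Term β) : Literal L α → Literal L β
  | .pos A => .pos (A.subst σ)
  | .neg A => .neg (A.subst σ)

/-- Apply a substitution to a conjunction. -/
def Conj.subst (σ : α → L.Term β) (C : Conj L α) : Conj L β := C.map (Literal.subst σ)

/-- Apply a substitution to a disjunction. -/
def Disj.subst (σ : α → L.Term β) (D : Disj L α) : Disj L β := D.map (Conj.subst σ)

/-- A ground term, regarded as a term over the variables. -/
def liftTerm (t : L.Term Empty) : L.Term ℕ := t.subst Empty.elim

/-- A ground atom, regarded as an atom over the variables. -/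
def Atom.lift (A : Atom L Empty) : Atom L ℕ := A.subst Empty.elim

/-- The variables that occur in an atom. -/
def Atom.vars : Atom L ℕ → Set ℕ
  | .eq s t => (s.varFinset : Set ℕ) ∪ (t.varFinset : Set ℕ)
  | .rel _ ts => ⋃ i, ((ts i).varFinset : Set ℕ)

/-- The variables that occur in a literal. -/
def Literal.vars : Literal L ℕ → Set ℕ
  | .pos A => A.vars
  | .neg A => A.vars

/-- The variables that occur in a conjunction. -/
def Conj.vars (C : Conj L ℕ) : Set ℕ := {x | ∃ l ∈ C, x ∈ l.vars}

/-- The variables that occur in a disjunction. -/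
def Disj.vars (D : Disj L ℕ) : Set ℕ := {x | ∃ C ∈ D, x ∈ Conj.vars C}

/-- A predicate definition `(p(V₁, …, Vₙ), ∃ W [D])`: the `Vᵢ` are distinct variables and `D` is a
nonempty disjunction.  The set `W` is determined by the rest, see `PredDef.localVars`. -/
structure PredDef (L : FirstOrder.Language.{u, v}) where
  arity : ℕ
  pred : L.Relations arity
  headVar : Fin arity → ℕ
  headVar_injective : Function.Injective headVar
  disj : Disj L ℕ
  disj_ne_nil : disj ≠ []

/-- The predicate symbol of a definition, together with its arity. -/
def PredDef.symbol (d : PredDef L) : Σ n, L.Relations n := ⟨d.arity, d.pred⟩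

/-- The local variables `W = vars(D) \ vars(H)`. -/
def PredDef.localVars (d : PredDef L) : Set ℕ := Disj.vars d.disj \ Set.range d.headVar

/-- The substitution that replaces the head variable `Vᵢ` by `ts i` and renames every other
variable `x` to `η x`. -/
noncomputable def PredDef.inst (d : PredDef L) (ts : Fin d.arity → L.Term ℕ) (η : ℕ → ℕ) :
    ℕ → L.Term ℕ := by
  classical
  exact fun x => if h : ∃ i, d.headVar i = x then ts h.choose else FirstOrder.Language.Term.var (η x)

theorem PredDef.inst_headVar (d : PredDef L) (ts : Fin d.arity → L.Term ℕ) (η : ℕ → ℕ)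
    (i : Fin d.arity) : d.inst ts η (d.headVar i) = ts i := by
  have h : ∃ j, d.headVar j = d.headVar i := ⟨i, rfl⟩
  have hc : h.choose = i := d.headVar_injective h.choose_spec
  simp [PredDef.inst, hc]

theorem PredDef.inst_of_notMem (d : PredDef L) (ts : Fin d.arity → L.Term ℕ) (η : ℕ → ℕ)
    {x : ℕ} (hx : x ∉ Set.range d.headVar) :
    d.inst ts η x = FirstOrder.Language.Term.var (η x) := by
  have h : ¬ ∃ i, d.headVar i = x := hx
  simp only [PredDef.inst, dif_neg h]

/-- The head of the head grounding of `d` in which the head variables are replaced by the ground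
terms `ts`. -/
def PredDef.groundHead (d : PredDef L) (ts : Fin d.arity → L.Term Empty) : Atom L Empty :=
  .rel d.pred ts

/-- The (existentially closed) disjunction of the head grounding of `d` in which the head variables
are replaced by the ground terms `ts`; the local variables are unchanged. -/
noncomputable def PredDef.groundBody (d : PredDef L) (ts : Fin d.arity → L.Term Empty) :
    Disj L ℕ :=
  Disj.subst (d.inst (fun i => liftTerm (ts i)) id) d.disj

/-- A program is a finite set of predicate definitions, at most one for each predicate symbol. -/
structure Program (L : FirstOrder.Language.{u, v}) where
  defs : Set (PredDef L)
  finite : defs.Finite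
  unique : ∀ d ∈ defs, ∀ e ∈ defs, d.symbol = e.symbol → d = e

/-! ## Truth values and interpretations -/

/-- The four truth values: undefined, false, true, inadmissible. -/
inductive Four
  | u | f | t | i

/-- The information ordering on truth values. -/
instance : LE Four := ⟨fun a b => a = .u ∨ a = b ∨ b = .i⟩

open Classical in
/-- The truth value of something that is made true iff `tr`, and made false iff `fa`. -/
noncomputable def Four.ofProps (tr fa : Prop) : Four :=
  if tr then (if fa then .i else .t) else (if fa then .f else .u)

/-- A four-valued interpretation, as the pair of the set `T` of ground atoms deemed true and the
set `F` of ground atoms deemed false; equality atoms have their standard value. -/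
@[ext]
structure Interp (L : FirstOrder.Language.{u, v}) where
  T : Set (Atom L Empty)
  F : Set (Atom L Empty)
  eq_T : ∀ s t : L.Term Empty, Atom.eq s t ∈ T ↔ s = t
  eq_F : ∀ s t : L.Term Empty, Atom.eq s t ∈ F ↔ s ≠ t

namespace Interp

/-- The truth value `I(A)` of a ground atom. -/
noncomputable def val (I : Interp L) (A : Atom L Empty) : Four := Four.ofProps (A ∈ I.T) (A ∈ I.F)

/-- `I` makes a ground literal true. -/
def LitTrue (I : Interp L) : Literal L Empty → Prop
  | .pos A => A ∈ I.T
  | .neg A => A ∈ I.F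

/-- `I` makes a ground literal false. -/
def LitFalse (I : Interp L) : Literal L Empty → Prop
  | .pos A => A ∈ I.F
  | .neg A => A ∈ I.T

/-- `I` makes a ground conjunction true. -/
def ConjTrue (I : Interp L) (C : Conj L Empty) : Prop := ∀ l ∈ C, I.LitTrue l

/-- `I` makes a ground conjunction false. -/
def ConjFalse (I : Interp L) (C : Conj L Empty) : Prop := ∃ l ∈ C, I.LitFalse l

/-- `I` makes a ground disjunction true. -/
def DisjTrue (I : Interp L) (D : Disj L Empty) : Prop := ∃ C ∈ D, I.ConjTrue C

/-- `I` makes a ground disjunction false. -/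
def DisjFalse (I : Interp L) (D : Disj L Empty) : Prop := ∀ C ∈ D, I.ConjFalse C

/-- `I` makes the existential closure of `D` true: it makes some ground instance true. -/
def ExTrue (I : Interp L) (D : Disj L ℕ) : Prop :=
  ∃ σ : ℕ → L.Term Empty, I.DisjTrue (Disj.subst σ D)

/-- `I` makes the existential closure of `D` false: it makes all ground instances false. -/
def ExFalse (I : Interp L) (D : Disj L ℕ) : Prop :=
  ∀ σ : ℕ → L.Term Empty, I.DisjFalse (Disj.subst σ D)

/-- The truth value of the existential closure of `D`. -/
noncomputable def exVal (I : Interp L) (D : Disj L ℕ) : Four :=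
  Four.ofProps (I.ExTrue D) (I.ExFalse D)

/-- The information ordering on interpretations. -/
instance : PartialOrder (Interp L) where
  le I J := I.T ⊆ J.T ∧ I.F ⊆ J.F
  le_refl I := ⟨subset_rfl, subset_rfl⟩
  le_trans I J K h k := ⟨h.1.trans k.1, h.2.trans k.2⟩
  le_antisymm I J h k := Interp.ext (h.1.antisymm k.1) (h.2.antisymm k.2)

/-- The ordering is the pointwise extension of the information ordering on truth values. -/
theorem le_iff_val (I J : Interp L) : I ≤ J ↔ ∀ A, I.val A ≤ J.val A := by
  have key : ∀ p q r s : Prop,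
      (Four.ofProps p q ≤ Four.ofProps r s) ↔ ((p → r) ∧ (q → s)) := by
    intro p q r s
    change (_ = _ ∨ _ = _ ∨ _ = _) ↔ _
    by_cases p <;> by_cases q <;> by_cases r <;> by_cases s <;> simp_all [Four.ofProps]
  simp only [val, key]
  exact ⟨fun h A => ⟨fun a => h.1 a, fun a => h.2 a⟩,
    fun h => ⟨fun A a => (h A).1 a, fun A a => (h A).2 a⟩⟩

/-- The interpretation with given true and false atoms, except that equality atoms have their
standard value. -/
def ofSets (T F : Set (Atom L Empty)) : Interp L where
  T := {A | match A with
    | .eq s t => s = t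
    | .rel p ts => Atom.rel p ts ∈ T}
  F := {A | match A with
    | .eq s t => s ≠ t
    | .rel p ts => Atom.rel p ts ∈ F}
  eq_T _ _ := Iff.rfl
  eq_F _ _ := Iff.rfl

theorem isGLB_ofSets (s : Set (Interp L)) :
    IsGLB s (ofSets {A | ∀ I ∈ s, A ∈ I.T} {A | ∀ I ∈ s, A ∈ I.F}) := by
  constructor
  · intro I hI
    constructor
    · rintro (⟨a, b⟩ | ⟨p, ts⟩) h
      · exact (I.eq_T a b).2 h
      · exact h I hI
    · rintro (⟨a, b⟩ | ⟨p, ts⟩) h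
      · exact (I.eq_F a b).2 h
      · exact h I hI
  · intro J hJ
    constructor
    · rintro (⟨a, b⟩ | ⟨p, ts⟩) h
      · exact (J.eq_T a b).1 h
      · exact fun I hI => (hJ hI).1 h
    · rintro (⟨a, b⟩ | ⟨p, ts⟩) h
      · exact (J.eq_F a b).1 h
      · exact fun I hI => (hJ hI).2 h

noncomputable instance : InfSet (Interp L) :=
  ⟨fun s => ofSets {A | ∀ I ∈ s, A ∈ I.T} {A | ∀ I ∈ s, A ∈ I.F}⟩

/-- Interpretations form a complete lattice for the information ordering. -/
noncomputable instance : CompleteLattice (Interp L) := completeLatticeOfInf (Interp L) isGLB_ofSets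

theorem litTrue_mono {I J : Interp L} (h : I ≤ J) {l : Literal L Empty} (hl : I.LitTrue l) :
    J.LitTrue l := by
  cases l with
  | pos A => exact h.1 hl
  | neg A => exact h.2 hl

theorem litFalse_mono {I J : Interp L} (h : I ≤ J) {l : Literal L Empty} (hl : I.LitFalse l) :
    J.LitFalse l := by
  cases l with
  | pos A => exact h.2 hl
  | neg A => exact h.1 hl

theorem exTrue_mono {I J : Interp L} (h : I ≤ J) {D : Disj L ℕ} (hD : I.ExTrue D) :
    J.ExTrue D := by
  obtain ⟨σ, C, hC, hT⟩ := hD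
  exact ⟨σ, C, hC, fun l hl => litTrue_mono h (hT l hl)⟩

theorem exFalse_mono {I J : Interp L} (h : I ≤ J) {D : Disj L ℕ} (hD : I.ExFalse D) :
    J.ExFalse D := by
  intro σ C hC
  obtain ⟨l, hl, hF⟩ := hD σ C hC
  exact ⟨l, hl, litFalse_mono h hF⟩

end Interp

/-! ## The immediate consequence operator -/

namespace Program

/-- The immediate consequence operator.  The value of a ground atom `H` in `Φ_P(I)` is the value in
`I` of the body of the head grounding with head `H` (`phi_val` below); an atom whose predicate has
no definition has the value false, that of an empty disjunction (`phi_val_of_undefined` below). -/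
noncomputable def phiFun (P : Program L) (I : Interp L) : Interp L :=
  Interp.ofSets
    {H | ∃ d ∈ P.defs, ∃ ts, d.groundHead ts = H ∧ I.ExTrue (d.groundBody ts)}
    {H | ∀ d ∈ P.defs, ∀ ts, d.groundHead ts = H → I.ExFalse (d.groundBody ts)}

theorem phiFun_mono (P : Program L) : Monotone P.phiFun := by
  intro I J h
  constructor
  · rintro (⟨a, b⟩ | ⟨p, ts⟩) hA
    · exact hA
    · obtain ⟨d, hd, us, hH, hT⟩ := hA
      exact ⟨d, hd, us, hH, Interp.exTrue_mono h hT⟩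
  · rintro (⟨a, b⟩ | ⟨p, ts⟩) hA
    · exact hA
    · exact fun d hd us hH => Interp.exFalse_mono h (hA d hd us hH)

/-- `Φ_P`, as a monotone operator on the complete lattice of interpretations. -/
noncomputable def phi (P : Program L) : Interp L →o Interp L := ⟨P.phiFun, P.phiFun_mono⟩

theorem groundHead_inj (P : Program L) {d e : PredDef L} (hd : d ∈ P.defs) (he : e ∈ P.defs)
    {ts : Fin d.arity → L.Term Empty} {us : Fin e.arity → L.Term Empty}
    (h : d.groundHead ts = e.groundHead us) :
    (⟨d, ts⟩ : Σ d : PredDef L, Fin d.arity → L.Term Empty) = ⟨e, us⟩ := by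
  have hs : d.symbol = e.symbol := by
    simp only [PredDef.groundHead, Atom.rel.injEq] at h
    exact Sigma.ext h.1 h.2.1
  have hde := P.unique d hd e he hs
  subst hde
  simp only [PredDef.groundHead, Atom.rel.injEq, heq_eq_eq, true_and] at h
  rw [h]

theorem phi_val (P : Program L) (I : Interp L) {d : PredDef L} (hd : d ∈ P.defs)
    (ts : Fin d.arity → L.Term Empty) :
    (P.phi I).val (d.groundHead ts) = I.exVal (d.groundBody ts) := by
  have hT : d.groundHead ts ∈ (P.phi I).T ↔ I.ExTrue (d.groundBody ts) := by
    constructor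
    · rintro ⟨e, he, us, hH, h⟩
      cases P.groundHead_inj he hd hH
      exact h
    · exact fun h => ⟨d, hd, ts, rfl, h⟩
  have hF : d.groundHead ts ∈ (P.phi I).F ↔ I.ExFalse (d.groundBody ts) := by
    constructor
    · exact fun h => h d hd ts rfl
    · intro h e he us hH
      cases P.groundHead_inj he hd hH
      exact h
  simp only [Interp.val, Interp.exVal, hT, hF]

theorem phi_val_of_undefined (P : Program L) (I : Interp L) {n : ℕ} (p : L.Relations n)
    (hp : ∀ d ∈ P.defs, d.symbol ≠ ⟨n, p⟩) (ts : Fin n → L.Term Empty) :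
    (P.phi I).val (Atom.rel p ts) = .f := by
  have hne : ∀ d ∈ P.defs, ∀ us, d.groundHead us ≠ Atom.rel p ts := by
    intro d hd us h
    simp only [PredDef.groundHead, Atom.rel.injEq] at h
    exact hp d hd (Sigma.ext h.1 h.2.1)
  have hT : Atom.rel p ts ∉ (P.phi I).T := fun ⟨d, hd, us, h, _⟩ => hne d hd us h
  have hF : Atom.rel p ts ∈ (P.phi I).F := fun d hd us h => (hne d hd us h).elim
  simp [Interp.val, Four.ofProps, hT, hF]

/-- The least fixed point of `Φ_P` in the information ordering. -/
noncomputable def lfpPhi (P : Program L) : Interp L := OrderHom.lfp P.phi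

end Program

/-! ## Operational semantics: SLDNF resolution

A goal is a conjunction of literals.  The computation rule is arbitrary: at every node any literal
may be selected, except that a negated atom may be selected only when it is ground.  An equality
atom is solved by unification. -/

/-- `σ` is a unifier of `s` and `t`. -/
def IsUnifier (σ : ℕ → L.Term ℕ) (s t : L.Term ℕ) : Prop := s.subst σ = t.subst σ

/-- `σ` is a most general unifier of `s` and `t`: every unifier factors through it. -/
def IsMGU (σ : ℕ → L.Term ℕ) (s t : L.Term ℕ) : Prop :=
  IsUnifier σ s t ∧
    ∀ τ : ℕ → L.Term ℕ, IsUnifier τ s t → ∃ δ : ℕ → L.Term ℕ, ∀ x, τ x = (σ x).subst δ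

/-- `η` renames the local variables of `d` to distinct variables that do not occur in the goal. -/
def PredDef.RenamesApart (d : PredDef L) (η : ℕ → ℕ) (G : Conj L ℕ) : Prop :=
  Set.InjOn η d.localVars ∧ ∀ x ∈ d.localVars, η x ∉ Conj.vars G

mutual

/-- The goal has a successful SLDNF derivation. -/
inductive GoalSucceeds (P : Program L) : Conj L ℕ → Prop
  /-- The empty goal. -/
  | nil : GoalSucceeds P []
  /-- The selected atom is replaced by a disjunct of the body of its definition. -/
  | unfold (G₁ G₂ : Conj L ℕ) (d : PredDef L) (ts : Fin d.arity → L.Term ℕ) (η : ℕ → ℕ)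
      (C : Conj L ℕ) (hd : d ∈ P.defs)
      (hη : d.RenamesApart η (G₁ ++ Literal.pos (Atom.rel d.pred ts) :: G₂))
      (hC : C ∈ d.disj)
      (h : GoalSucceeds P (G₁ ++ Conj.subst (d.inst ts η) C ++ G₂)) :
      GoalSucceeds P (G₁ ++ Literal.pos (Atom.rel d.pred ts) :: G₂)
  /-- The selected equality is solved by a most general unifier. -/
  | unify (G₁ G₂ : Conj L ℕ) (s t : L.Term ℕ) (σ : ℕ → L.Term ℕ) (hσ : IsMGU σ s t)
      (h : GoalSucceeds P (Conj.subst σ (G₁ ++ G₂))) :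
      GoalSucceeds P (G₁ ++ Literal.pos (Atom.eq s t) :: G₂)
  /-- The selected ground negated atom is removed if the atom finitely fails. -/
  | neg (G₁ G₂ : Conj L ℕ) (A : Atom L Empty) (hA : GoalFails P [Literal.pos A.lift])
      (h : GoalSucceeds P (G₁ ++ G₂)) :
      GoalSucceeds P (G₁ ++ Literal.neg A.lift :: G₂)

/-- The goal has a finitely failed SLDNF tree. -/
inductive GoalFails (P : Program L) : Conj L ℕ → Prop
  /-- The selected atom is replaced by each of the disjuncts of the body of its definition, and
  all the resulting goals fail. -/
  | unfold (G₁ G₂ : Conj L ℕ) (d : PredDef L) (ts : Fin d.arity → L.Term ℕ) (η : ℕ → ℕ)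
      (hd : d ∈ P.defs)
      (hη : d.RenamesApart η (G₁ ++ Literal.pos (Atom.rel d.pred ts) :: G₂))
      (h : ∀ C ∈ d.disj, GoalFails P (G₁ ++ Conj.subst (d.inst ts η) C ++ G₂)) :
      GoalFails P (G₁ ++ Literal.pos (Atom.rel d.pred ts) :: G₂)
  /-- The predicate of the selected atom has no definition. -/
  | undefined (G₁ G₂ : Conj L ℕ) {n : ℕ} (p : L.Relations n) (ts : Fin n → L.Term ℕ)
      (hp : ∀ d ∈ P.defs, d.symbol ≠ ⟨n, p⟩) :
      GoalFails P (G₁ ++ Literal.pos (Atom.rel p ts) :: G₂)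
  /-- The selected equality is solved by a most general unifier, and the resulting goal fails. -/
  | unify (G₁ G₂ : Conj L ℕ) (s t : L.Term ℕ) (σ : ℕ → L.Term ℕ) (hσ : IsMGU σ s t)
      (h : GoalFails P (Conj.subst σ (G₁ ++ G₂))) :
      GoalFails P (G₁ ++ Literal.pos (Atom.eq s t) :: G₂)
  /-- The selected equality has no unifier. -/
  | clash (G₁ G₂ : Conj L ℕ) (s t : L.Term ℕ) (h : ∀ σ : ℕ → L.Term ℕ, ¬ IsUnifier σ s t) :
      GoalFails P (G₁ ++ Literal.pos (Atom.eq s t) :: G₂)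
  /-- The selected ground negated atom is removed since the atom finitely fails, and the remaining
  goal fails. -/
  | neg (G₁ G₂ : Conj L ℕ) (A : Atom L Empty) (hA : GoalFails P [Literal.pos A.lift])
      (h : GoalFails P (G₁ ++ G₂)) :
      GoalFails P (G₁ ++ Literal.neg A.lift :: G₂)
  /-- The selected negated atom is ground and the atom succeeds. -/
  | negSucceeds (G₁ G₂ : Conj L ℕ) (A : Atom L Empty)
      (hA : GoalSucceeds P [Literal.pos A.lift]) :
      GoalFails P (G₁ ++ Literal.neg A.lift :: G₂)

end

/-- The ground atom `A` can succeed: for some computation rule there is a successful SLDNF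
derivation of it. -/
def Program.Succeeds (P : Program L) (A : Atom L Empty) : Prop :=
  GoalSucceeds P [Literal.pos A.lift]

/-- The ground atom `A` can finitely fail: for some computation rule there is a finitely failed
SLDNF tree for it. -/
def Program.FinitelyFails (P : Program L) (A : Atom L Empty) : Prop :=
  GoalFails P [Literal.pos A.lift]

end LogicProg

namespace LogicProg

variable {L : FirstOrder.Language.{u, v}} {α β γ : Type}

/-! ## Substitution -/

-- SLDNF resolution is sound for every fixed point `I` of `Φ_P`, the least one included: a goal that
-- succeeds has a ground instance made true by `I`, and a goal that finitely fails has all its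
-- ground instances made false. The two claims are proved together (`GoalSucceeds.exists_conjTrue`,
-- `GoalFails.conjFalse`), since each calls the other at a negated atom; the recursion descends
-- through the finite derivations, so no stratification of the program is needed.
--
-- A true instance is carried backwards along a derivation by composing substitutions. Failure must
-- cover an arbitrary ground instance: at an unfolding, it is extended to the renamed local
-- variables (`PredDef.RenamesApart.exists_extension`); at an equality, it either separates the two
-- sides or factors through the most general unifier (`IsMGU.exists_ground`).
--
-- For a ground atom, soundness places it in `T` or `F` of the least fixed point, hence of any
-- larger interpretation, which excludes the values in question.

theorem term_subst_congr {σ τ : ℕ → L.Term β} {t : L.Term ℕ}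
    (h : ∀ x ∈ t.varFinset, σ x = τ x) : t.subst σ = t.subst τ := by
  induction t with
  | var x => exact h x (by simp [FirstOrder.Language.Term.varFinset])
  | func f ts ih =>
    simp only [FirstOrder.Language.Term.subst, FirstOrder.Language.Term.func.injEq, heq_eq_eq, true_and]
    funext i
    refine ih i fun x hx => h x ?_
    simp only [FirstOrder.Language.Term.varFinset, Finset.mem_biUnion, Finset.mem_univ, true_and]
    exact ⟨i, hx⟩

theorem term_subst_subst (σ : α → L.Term β) (τ : β → L.Term γ) (t : L.Term α) :
    (t.subst σ).subst τ = t.subst fun x => (σ x).subst τ := by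
  induction t with
  | var x => rfl
  | func f ts ih => simp [FirstOrder.Language.Term.subst, ih]

theorem term_subst_empty (σ : Empty → L.Term Empty) (t : L.Term Empty) : t.subst σ = t := by
  induction t with
  | var x => exact x.elim
  | func f ts ih => simp [FirstOrder.Language.Term.subst, ih]

theorem liftTerm_subst (σ : ℕ → L.Term Empty) (t : L.Term Empty) : (liftTerm t).subst σ = t := by
  rw [liftTerm, term_subst_subst, term_subst_empty]

theorem Atom.subst_subst (σ : α → L.Term β) (τ : β → L.Term γ) (A : Atom L α) :
    (A.subst σ).subst τ = A.subst fun x => (σ x).subst τ := by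
  cases A <;> simp [Atom.subst, term_subst_subst]

theorem Atom.lift_subst (σ : ℕ → L.Term Empty) (A : Atom L Empty) : A.lift.subst σ = A := by
  rw [Atom.lift, Atom.subst_subst]
  cases A <;> simp [Atom.subst, term_subst_empty]

theorem Literal.subst_subst (σ : α → L.Term β) (τ : β → L.Term γ) (l : Literal L α) :
    (l.subst σ).subst τ = l.subst fun x => (σ x).subst τ := by
  cases l <;> simp [Literal.subst, Atom.subst_subst]

theorem Conj.subst_subst (σ : α → L.Term β) (τ : β → L.Term γ) (C : Conj L α) :
    Conj.subst τ (Conj.subst σ C) = Conj.subst (fun x => (σ x).subst τ) C := by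
  simp [Conj.subst, Literal.subst_subst]

theorem Conj.subst_append (σ : α → L.Term β) (C D : Conj L α) :
    Conj.subst σ (C ++ D) = Conj.subst σ C ++ Conj.subst σ D := List.map_append

theorem Conj.subst_cons (σ : α → L.Term β) (l : Literal L α) (C : Conj L α) :
    Conj.subst σ (l :: C) = l.subst σ :: Conj.subst σ C := rfl

theorem Atom.subst_congr {σ τ : ℕ → L.Term β} {A : Atom L ℕ} (h : ∀ x ∈ A.vars, σ x = τ x) :
    A.subst σ = A.subst τ := by
  cases A with
  | eq s t =>
    simp only [Atom.subst]
    rw [term_subst_congr fun x hx => h x (Or.inl hx), term_subst_congr fun x hx => h x (Or.inr hx)]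
  | rel p ts =>
    simp only [Atom.subst]
    congr 1
    funext i
    exact term_subst_congr fun x hx => h x (Set.mem_iUnion.2 ⟨i, hx⟩)

theorem Literal.subst_congr {σ τ : ℕ → L.Term β} {l : Literal L ℕ}
    (h : ∀ x ∈ l.vars, σ x = τ x) : l.subst σ = l.subst τ := by
  cases l <;> exact congrArg _ (Atom.subst_congr h)

theorem Conj.subst_congr {σ τ : ℕ → L.Term β} {C : Conj L ℕ}
    (h : ∀ x ∈ Conj.vars C, σ x = τ x) : Conj.subst σ C = Conj.subst τ C :=
  List.map_congr_left fun l hl => Literal.subst_congr fun x hx => h x ⟨l, hl, hx⟩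

/-- If `σ` and `τ` agree along the renaming `η` of the local variables, then instantiating the body
with `ts` and grounding by `σ` is the same as grounding the head first and then the local
variables by `τ`. -/
theorem PredDef.subst_inst_eq (d : PredDef L) {ts : Fin d.arity → L.Term ℕ} {η : ℕ → ℕ}
    {us : Fin d.arity → L.Term Empty} {σ τ : ℕ → L.Term Empty}
    (hts : ∀ i, (ts i).subst σ = us i) (hη : ∀ x ∈ d.localVars, σ (η x) = τ x)
    {C : Conj L ℕ} (hC : C ∈ d.disj) :
    Conj.subst σ (Conj.subst (d.inst ts η) C) =
      Conj.subst τ (Conj.subst (d.inst (fun i => liftTerm (us i)) id) C) := by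
  rw [Conj.subst_subst, Conj.subst_subst]
  refine Conj.subst_congr fun x hx => ?_
  by_cases hd : x ∈ Set.range d.headVar
  · obtain ⟨i, rfl⟩ := hd
    rw [d.inst_headVar, d.inst_headVar, liftTerm_subst, hts]
  · rw [d.inst_of_notMem _ _ hd, d.inst_of_notMem _ _ hd]
    exact hη x ⟨⟨C, hC, hx⟩, hd⟩

/-- A substitution of the goal and one of the local variables, renamed apart from the goal, have a
common extension. -/
theorem PredDef.RenamesApart.exists_extension {d : PredDef L} {η : ℕ → ℕ} {G : Conj L ℕ}
    (h : d.RenamesApart η G) (σ τ : ℕ → L.Term Empty) :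
    ∃ ρ : ℕ → L.Term Empty,
      (∀ x ∈ Conj.vars G, ρ x = σ x) ∧ ∀ x ∈ d.localVars, ρ (η x) = τ x := by
  classical
  -- Use `τ` on the renamed local variables and `σ` elsewhere: the former avoid the goal, and
  -- injectivity of `η` makes the chosen preimage the right one.
  refine ⟨fun y => if hy : ∃ x ∈ d.localVars, η x = y then τ hy.choose else σ y, ?_, ?_⟩
  · intro x hx
    have hn : ¬ ∃ y ∈ d.localVars, η y = x := by
      rintro ⟨y, hy, rfl⟩
      exact h.2 y hy hx
    exact dif_neg hn
  · intro x hx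
    have hy : ∃ y ∈ d.localVars, η y = η x := ⟨x, hx, rfl⟩
    simp only [dif_pos hy]
    rw [h.1 hy.choose_spec.1 hx hy.choose_spec.2]

/-- A ground unifier factors through a most general unifier, by a ground substitution. -/
theorem IsMGU.exists_ground [Nonempty L.Constants] {σ : ℕ → L.Term ℕ} {s t : L.Term ℕ}
    (h : IsMGU σ s t) {τ : ℕ → L.Term Empty} (hτ : s.subst τ = t.subst τ) :
    ∃ δ : ℕ → L.Term Empty, τ = fun x => (σ x).subst δ := by
  obtain ⟨c⟩ := ‹Nonempty L.Constants›
  -- Most generality quantifies over substitutions with variables, so `τ` is first lifted to one.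
  have hu : IsUnifier (fun x => liftTerm (τ x)) s t := by
    simp only [IsUnifier, liftTerm, ← term_subst_subst, hτ]
  obtain ⟨δ, hδ⟩ := h.2 _ hu
  -- The factor `δ` need not be ground; sending its variables to a constant is harmless, as the
  -- composite has ground values anyway.
  refine ⟨fun y => (δ y).subst fun _ => c.term, funext fun x => ?_⟩
  rw [← term_subst_subst, ← hδ, liftTerm_subst]

/-! ## Truth values of conjunctions -/

namespace Interp

variable {I : Interp L} {C D : Conj L Empty} {l : Literal L Empty}

theorem conjTrue_append : I.ConjTrue (C ++ D) ↔ I.ConjTrue C ∧ I.ConjTrue D :=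
  List.forall_mem_append

theorem conjTrue_cons : I.ConjTrue (l :: C) ↔ I.LitTrue l ∧ I.ConjTrue C :=
  List.forall_mem_cons

theorem conjFalse_append : I.ConjFalse (C ++ D) ↔ I.ConjFalse C ∨ I.ConjFalse D := by
  simp [ConjFalse, or_and_right, exists_or]

theorem conjFalse_cons : I.ConjFalse (l :: C) ↔ I.LitFalse l ∨ I.ConjFalse C := by
  simp [ConjFalse]

/-- A lifted ground atom is its own only ground instance, so for such goals "some instance" and "all
instances" coincide. -/
theorem conjTrue_singleton_lift {A : Atom L Empty} {σ : ℕ → L.Term Empty} :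
    I.ConjTrue (Conj.subst σ [Literal.pos A.lift]) ↔ A ∈ I.T := by
  simp [ConjTrue, Conj.subst, Literal.subst, Atom.lift_subst, LitTrue]

theorem conjFalse_singleton_lift {A : Atom L Empty} {σ : ℕ → L.Term Empty} :
    I.ConjFalse (Conj.subst σ [Literal.pos A.lift]) ↔ A ∈ I.F := by
  simp [ConjFalse, Conj.subst, Literal.subst, Atom.lift_subst, LitFalse]

end Interp

/-! ## Soundness of SLDNF resolution -/

theorem Program.phi_lfpPhi (P : Program L) : P.phi P.lfpPhi = P.lfpPhi := OrderHom.map_lfp P.phi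

section Soundness

open Interp

variable [Nonempty L.Constants] {P : Program L} {I : Interp L}

mutual

/-- In a fixed point of `Φ_P`, a goal that succeeds has a true ground instance. -/
theorem GoalSucceeds.exists_conjTrue (hI : P.phi I = I) {G : Conj L ℕ} (h : GoalSucceeds P G) :
    ∃ σ : ℕ → L.Term Empty, I.ConjTrue (Conj.subst σ G) := by
  match G, h with
  | _, .nil =>
    obtain ⟨c⟩ := ‹Nonempty L.Constants›
    exact ⟨fun _ => c.term, fun l hl => by simp [Conj.subst] at hl⟩
  | _, .unfold G₁ G₂ d ts η C hd hη hC h =>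
    obtain ⟨σ, hσ⟩ := h.exists_conjTrue hI
    refine ⟨σ, ?_⟩
    simp only [Conj.subst_append, Conj.subst_cons, conjTrue_append, conjTrue_cons] at hσ ⊢
    refine ⟨hσ.1.1, ?_, hσ.2⟩
    have hT : d.groundHead (fun i => (ts i).subst σ) ∈ (P.phi I).T :=
      -- The existential witness for a local variable is the value that `σ` gives to its renamed
      -- copy.
      ⟨d, hd, _, rfl, fun x => σ (η x), _, List.mem_map_of_mem (List.mem_map_of_mem hC),
        d.subst_inst_eq (fun _ => rfl) (fun _ _ => rfl) hC ▸ hσ.1.2⟩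
    rwa [hI] at hT
  | _, .unify G₁ G₂ s t σ hσ h =>
    obtain ⟨τ, hτ⟩ := h.exists_conjTrue hI
    refine ⟨fun x => (σ x).subst τ, ?_⟩
    simp only [Conj.subst_subst, Conj.subst_append, Conj.subst_cons, conjTrue_append,
      conjTrue_cons] at hτ ⊢
    refine ⟨hτ.1, (I.eq_T _ _).2 ?_, hτ.2⟩
    rw [← term_subst_subst, ← term_subst_subst, show s.subst σ = t.subst σ from hσ.1]
  | _, .neg G₁ G₂ A hA h =>
    obtain ⟨σ, hσ⟩ := h.exists_conjTrue hI
    have hF := conjFalse_singleton_lift.1 (hA.conjFalse hI σ)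
    refine ⟨σ, ?_⟩
    simp only [Conj.subst_append, Conj.subst_cons, conjTrue_append, conjTrue_cons] at hσ ⊢
    exact ⟨hσ.1, by simpa [Literal.subst, Atom.lift_subst, LitTrue] using hF, hσ.2⟩

/-- In a fixed point of `Φ_P`, all ground instances of a goal that finitely fails are false. -/
theorem GoalFails.conjFalse (hI : P.phi I = I) {G : Conj L ℕ} (h : GoalFails P G)
    (σ : ℕ → L.Term Empty) : I.ConjFalse (Conj.subst σ G) := by
  match G, h with
  | _, .unfold G₁ G₂ d ts η hd hη h =>
    -- If the rest of the goal is not already false, the falsity of each resulting goal must come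
    -- from the unfolded disjunct.
    by_cases hG : I.ConjFalse (Conj.subst σ G₁) ∨ I.ConjFalse (Conj.subst σ G₂)
    · simp only [Conj.subst_append, Conj.subst_cons, conjFalse_append, conjFalse_cons]
      tauto
    have hF : d.groundHead (fun i => (ts i).subst σ) ∈ (P.phi I).F := by
      intro e he us hH
      cases P.groundHead_inj he hd hH
      intro τ C' hC'
      obtain ⟨C'', hC'', rfl⟩ := List.mem_map.1 hC'
      obtain ⟨C, hC, rfl⟩ := List.mem_map.1 hC''
      -- Falsity of the body concerns every `τ` on the local variables; `ρ` realises `τ` there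
      -- without changing the rest of the goal.
      obtain ⟨ρ, hρσ, hρτ⟩ := hη.exists_extension σ τ
      have hts : ∀ i, (ts i).subst ρ = (ts i).subst σ := fun i =>
        term_subst_congr fun x hx => hρσ x
          ⟨_, List.mem_append_right _ List.mem_cons_self, Set.mem_iUnion.2 ⟨i, hx⟩⟩
      have h₁ : Conj.subst ρ G₁ = Conj.subst σ G₁ := Conj.subst_congr fun x ⟨l, hl, hx⟩ =>
        hρσ x ⟨l, List.mem_append_left _ hl, hx⟩
      have h₂ : Conj.subst ρ G₂ = Conj.subst σ G₂ := Conj.subst_congr fun x ⟨l, hl, hx⟩ =>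
        hρσ x ⟨l, List.mem_append_right _ (List.mem_cons_of_mem _ hl), hx⟩
      have hC := (h C hC).conjFalse hI ρ
      rw [Conj.subst_append, Conj.subst_append, h₁, h₂, d.subst_inst_eq hts hρτ ‹_›] at hC
      simp only [conjFalse_append] at hC
      tauto
    rw [hI] at hF
    simp only [Conj.subst_append, Conj.subst_cons, conjFalse_append, conjFalse_cons]
    exact Or.inr (Or.inl hF)
  | _, .undefined G₁ G₂ p ts hp =>
    simp only [Conj.subst_append, Conj.subst_cons, conjFalse_append, conjFalse_cons]
    refine Or.inr (Or.inl ?_)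
    have hF : Atom.rel p (fun i => (ts i).subst σ) ∈ (P.phi I).F := by
      intro d hd us hH
      simp only [PredDef.groundHead, Atom.rel.injEq] at hH
      exact (hp d hd (Sigma.ext hH.1 hH.2.1)).elim
    rwa [hI] at hF
  | _, .unify G₁ G₂ s t μ hμ h =>
    -- An instance that does not equate the sides makes the equality itself false.
    by_cases hst : s.subst σ = t.subst σ
    · obtain ⟨δ, rfl⟩ := hμ.exists_ground hst
      have hδ := h.conjFalse hI δ
      simp only [Conj.subst_subst, Conj.subst_append, Conj.subst_cons, conjFalse_append,
        conjFalse_cons] at hδ ⊢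
      tauto
    · simp only [Conj.subst_append, Conj.subst_cons, conjFalse_append, conjFalse_cons]
      exact Or.inr (Or.inl ((I.eq_F _ _).2 hst))
  | _, .clash G₁ G₂ s t h =>
    simp only [Conj.subst_append, Conj.subst_cons, conjFalse_append, conjFalse_cons]
    -- A ground substitution equating the sides would lift to a unifier.
    refine Or.inr (Or.inl ((I.eq_F _ _).2 fun hst => h (fun x => liftTerm (σ x)) ?_))
    simp only [IsUnifier, liftTerm, ← term_subst_subst, hst]
  | _, .neg G₁ G₂ A hA h =>
    have hσ := h.conjFalse hI σ
    simp only [Conj.subst_append, Conj.subst_cons, conjFalse_append, conjFalse_cons] at hσ ⊢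
    tauto
  | _, .negSucceeds G₁ G₂ A hA =>
    obtain ⟨τ, hτ⟩ := hA.exists_conjTrue hI
    have hT := conjTrue_singleton_lift.1 hτ
    simp only [Conj.subst_append, Conj.subst_cons, conjFalse_append, conjFalse_cons]
    exact Or.inr (Or.inl (by simpa [Literal.subst, Atom.lift_subst, LitFalse] using hT))

end

theorem Program.Succeeds.mem_lfpPhi {A : Atom L Empty} (h : P.Succeeds A) : A ∈ P.lfpPhi.T := by
  obtain ⟨σ, hσ⟩ := GoalSucceeds.exists_conjTrue P.phi_lfpPhi h
  exact conjTrue_singleton_lift.1 hσ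

theorem Program.FinitelyFails.mem_lfpPhi {A : Atom L Empty} (h : P.FinitelyFails A) :
    A ∈ P.lfpPhi.F := by
  have c : L.Constants := Classical.arbitrary _
  exact conjFalse_singleton_lift.1 (GoalFails.conjFalse P.phi_lfpPhi h fun _ => c.term)

end Soundness

end LogicProg

-- Transfer to interpretations above the least fixed point

theorem mainTheorem1 {L : FirstOrder.Language.{u, v}} [Nonempty L.Constants]
    (P : LogicProg.Program L) (I : LogicProg.Interp L) (hI : I ≥ P.lfpPhi) :
    (∀ A : LogicProg.Atom L Empty, I.val A = LogicProg.Four.t → ¬ P.FinitelyFails A) ∧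
    (∀ A : LogicProg.Atom L Empty, I.val A = LogicProg.Four.f → ¬ P.Succeeds A) ∧
    (∀ A : LogicProg.Atom L Empty, I.val A = LogicProg.Four.u →
      ¬ P.FinitelyFails A ∧ ¬ P.Succeeds A) := by
  have hF : ∀ {A}, P.FinitelyFails A → A ∈ I.F := fun h => hI.2 h.mem_lfpPhi
  have hT : ∀ {A}, P.Succeeds A → A ∈ I.T := fun h => hI.1 h.mem_lfpPhi
  simp only [LogicProg.Interp.val, LogicProg.Four.ofProps]
  refine ⟨fun A hA h => ?_, fun A hA h => ?_, fun A hA => ⟨fun h => ?_, fun h => ?_⟩⟩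
  -- The test on `F` occurs in both branches of `ofProps`, hence two rewrites; only `i` and `f`
  -- remain.
  · rw [if_pos (hF h), if_pos (hF h)] at hA
    split_ifs at hA
  · rw [if_pos (hT h)] at hA
    split_ifs at hA
  · rw [if_pos (hF h), if_pos (hF h)] at hA
    split_ifs at hA
  · rw [if_pos (hT h)] at hA
    split_ifs at hA
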